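/- Assume Dickson's conjecture (D): for every $k\ge 1$ and all linear maps $f_i(x)=a_ix+b_i$ ($i<k$) with $a_i,b_i$ non-negative integers and $a_i\ge 1$, if there is no integer $n>1$ dividing $\prod_{i<k}f_i(s)$ for every non-negative integer $s$, then there are infinitely many natural numbers $m$ such that $f_i(m)$ is prime for all $i<k$. Let $L^*=\{+,-,1,0,\mathrm{Pr},\mathrm{Pr}_n,P_n : 2\le n<\omega\}$, where $+$ is a binary function symbol, $-$ is a unary function symbol, $0,1$ are constants and all the predicates are unary. Let $M^*$ be the $L^*$-structure with universe $\mathbb Z$ in which $+$, $-$ (negation), $0$, $1$ have their usual meaning, $\mathrm{Pr}(x)$ holds iff $x$ is a prime number or the negation of a prime number, $P_n(x)$ holds iff $n\mid x$, and $\mathrm{Pr}_n(x)$ holds iff $n\mid x$ and $\mathrm{Pr}(x/n)$. Let $T^*=\mathrm{Th}(M^*)$ be the complete theory of $M^*$. Then $T^*$ eliminates quantifiers in $L^*$: for every $L^*$-formula $\varphi(x_0,\dots,x_{m-1})$ ($m\ge 0$) there is a quantifier-free $L^*$-formula $\psi(x_0,\dots,x_{m-1})$ such that $T^*\vdash\forall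 \bar x\,(\varphi(\bar x)\leftrightarrow\psi(\bar x))$. -/

import Mathlib

open FirstOrder

namespace PrimesInt

/-- Dickson's conjecture (D): let `k ≥ 1` and `f i (x) = a i * x + b i` (`i < k`) with `a i, b i`
non-negative integers and `a i ≥ 1`. If no integer `n > 1` divides the product of the `f i (s)` for
every non-negative integer `s`, then there are infinitely many natural numbers `m` such that all
the `f i (m)` are prime. -/
def DicksonConjecture : Prop :=
  ∀ (k : ℕ) (a b : Fin k → ℕ), 1 ≤ k → (∀ i, 1 ≤ a i) →
    (¬ ∃ n : ℕ, 1 < n ∧ ∀ s : ℕ, n ∣ ∏ i, (a i * s + b i)) →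
    {m : ℕ | ∀ i, (a i * m + b i).Prime}.Infinite

/-- The function symbols `0`, `1` (constants), `-` (unary), `+` (binary). -/
inductive Func : ℕ → Type
  | zero : Func 0
  | one : Func 0
  | neg : Func 1
  | add : Func 2

/-- The relation symbols, all unary: `Pr`, and for every `n ≥ 2` the symbols `Pr_n` and `P_n`. -/
inductive Rel : ℕ → Type
  | pr : Rel 1
  | prN (n : ℕ) (hn : 2 ≤ n) : Rel 1
  | dvd (n : ℕ) (hn : 2 ≤ n) : Rel 1

/-- The language `L* = {+, -, 1, 0, Pr, Pr_n, P_n : 2 ≤ n}`. -/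
def Lstar : FirstOrder.Language.{0, 0} where
  Functions := Func
  Relations := Rel

/-- The set `Pr` of (positive) primes and their negations. -/
def IsPr (x : ℤ) : Prop :=
  ∃ p : ℕ, p.Prime ∧ (x = p ∨ x = -p)

/-- The interpretation of the function symbols in `ℤ`. -/
def funInterp : ∀ {m : ℕ}, Func m → (Fin m → ℤ) → ℤ
  | _, .zero, _ => 0
  | _, .one, _ => 1
  | _, .neg, v => - v 0
  | _, .add, v => v 0 + v 1

/-- The interpretation of the relation symbols in `ℤ`: `Pr_n(x)` means `n ∣ x` and `Pr(x / n)`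
(the division is exact), and `P_n(x)` means `n ∣ x`. -/
def relInterp : ∀ {m : ℕ}, Rel m → (Fin m → ℤ) → Prop
  | _, .pr, v => IsPr (v 0)
  | _, .prN n _, v => (n : ℤ) ∣ v 0 ∧ IsPr (v 0 / (n : ℤ))
  | _, .dvd n _, v => (n : ℤ) ∣ v 0

/-- The standard `L*`-structure on `ℤ`. -/
instance : Lstar.Structure ℤ where
  funMap := funInterp
  RelMap := relInterp

/-- A theory `T` eliminates quantifiers: every formula `φ(x_0, …, x_{n-1})` is equivalent, modulo
`T`, to a quantifier-free formula `ψ(x_0, …, x_{n-1})` of the same language in the same variables. -/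
def EliminatesQuantifiers {L : FirstOrder.Language.{0, 0}} (T : L.Theory) : Prop :=
  ∀ (n : ℕ) (φ : L.Formula (Fin n)),
    ∃ ψ : L.Formula (Fin n), ψ.IsQF ∧ (φ ⇔[T] ψ)

end PrimesInt

/-!
Quantifier elimination for `(ℤ, +, Pr)` in the language `L*`, given Dickson's conjecture.

Since the theory in question is the complete theory of `ℤ`, it suffices to show that the sets
defined in `ℤ` by quantifier-free formulas are closed under projection along one variable `x`. A
quantifier-free formula only depends on the truth values of finitely many atomic conditions, each
saying that a form `a * x + t y`, with `t` an affine function of the parameters `y`, is zero, is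
divisible by `m`, or is `m` times `±` a prime (`exists_atoms_of_isQF`). So it is enough to decide,
quantifier-free in `y`, whether a system prescribing all these truth values is solvable in `x`
(`QFDef.exists_forall_iff`).

* If the system demands `n * x = s y` with `n ≠ 0`, multiply every condition by `n` and substitute
  (`QFDef.exists_mul_eq`); the predicates `Pr_n` and `P_n` make the result expressible.
* Otherwise, let `N` be a common multiple of the moduli, and fix the residue `r` of `x` modulo `N`.
  With `x = r + N * u`, the divisibility conditions no longer depend on `u`, and the other conditions
  say that certain forms `A i * u + B i` are prime up to sign, that certain forms `C j * u + D j` are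
  not, and that finitely many `u` are excluded. If for every prime `p` some `u` makes all
  `A i * u + B i` prime to `p`, and no `C j * u + D j` is `±` one of the `A i * u + B i`, then
  Dickson's conjecture yields infinitely many solutions
  (`DicksonConjecture.infinite_isPr_not_isPr`). This hypothesis is quantifier-free in `y`, because
  the local condition holds automatically at all primes above a bound that does not depend on `y`
  (`GenericAt`, `exists_of_genericAt`).
* If `x` is a solution for which the hypothesis fails, then a small prime `p` divides some
  `A i * u + B i`, which is prime up to sign, hence equal to `± p` (`genericAt_of_forall`). So `x`
  satisfies one of finitely many linear equations over `y`, and the first case applies.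
-/

open FirstOrder

namespace PrimesInt

/-! ### Consequences of Dickson's conjecture for linear forms over the integers -/

theorem isPr_iff_natAbs (x : ℤ) : IsPr x ↔ x.natAbs.Prime := by
  constructor
  · rintro ⟨p, hp, rfl | rfl⟩ <;> simpa using hp
  · intro h
    exact ⟨_, h, Int.natAbs_eq x⟩

theorem isPr_neg (x : ℤ) : IsPr (-x) ↔ IsPr x := by
  simp [isPr_iff_natAbs]

/-- Dickson's conjecture for linear forms over `ℤ` with arbitrary signs: replacing a form by its
negation makes the leading coefficients positive, and a translation of the variable makes the
constant terms nonnegative. -/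
theorem DicksonConjecture.infinite_isPr (hD : DicksonConjecture) {ι : Type*} [Finite ι]
    (A B : ι → ℤ) (hA : ∀ i, A i ≠ 0)
    (hloc : ∀ p : ℕ, p.Prime → ∃ u : ℤ, ∀ i, ¬ (p : ℤ) ∣ A i * u + B i) :
    {u : ℤ | ∀ i, IsPr (A i * u + B i)}.Infinite := by
  obtain ⟨k, ⟨e⟩⟩ := Finite.exists_equiv_fin ι
  rcases Nat.eq_zero_or_pos k with rfl | hk
  · have : IsEmpty ι := e.isEmpty
    simpa using Set.infinite_univ
  let c : ℤ := ∑ j : Fin k, |B (e.symm j)|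
  have hc : ∀ i, |B i| ≤ c := fun i => by
    have := Finset.single_le_sum (f := fun j : Fin k => |B (e.symm j)|)
      (fun j _ => abs_nonneg _) (Finset.mem_univ (e i))
    simpa using this
  have hpos : ∀ i, 1 ≤ |A i| := fun i => Int.one_le_abs (hA i)
  have hb : ∀ i, 0 ≤ (A i).sign * B i + |A i| * c := fun i => by
    have h1 : |(A i).sign * B i| ≤ c := by
      rw [abs_mul, Int.abs_sign_of_ne_zero (hA i), one_mul]; exact hc i
    have h2 := neg_abs_le ((A i).sign * B i)
    nlinarith [hpos i, (abs_nonneg (B i)).trans (hc i)]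
  let a : Fin k → ℕ := fun j => (A (e.symm j)).natAbs
  let b : Fin k → ℕ := fun j => ((A (e.symm j)).sign * B (e.symm j) + |A (e.symm j)| * c).toNat
  have key : ∀ j (s : ℕ), ((a j * s + b j : ℕ) : ℤ) =
      (A (e.symm j)).sign * (A (e.symm j) * (s + c) + B (e.symm j)) := fun j s => by
    have h1 : ((b j : ℕ) : ℤ) = (A (e.symm j)).sign * B (e.symm j) + |A (e.symm j)| * c :=
      Int.toNat_of_nonneg (hb _)
    have h2 : ((a j : ℕ) : ℤ) = |A (e.symm j)| := by simp [a]
    push_cast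
    rw [h1, h2, ← Int.sign_mul_self_eq_abs]
    ring
  have hsign : ∀ i (z : ℤ), ((A i).sign * z).natAbs = z.natAbs := fun i z => by
    rw [Int.natAbs_mul, Int.natAbs_sign_of_ne_zero (hA i), one_mul]
  have hinf := hD k a b hk (fun j => Int.natAbs_pos.mpr (hA _)) (by
    rintro ⟨n, hn, hdvd⟩
    obtain ⟨p, hp, hpn⟩ := Nat.exists_prime_and_dvd hn.ne'
    obtain ⟨u, hu⟩ := hloc p hp
    have hp0 : (0 : ℤ) < p := by exact_mod_cast hp.pos
    have h1 := hpn.trans (hdvd ((u - c) % p).toNat)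
    obtain ⟨j, -, hj⟩ := (hp.prime.dvd_finsetProd_iff _).mp h1
    apply hu (e.symm j)
    rw [← Int.natCast_dvd_natCast, key, ← Int.dvd_natAbs, hsign, Int.dvd_natAbs,
      Int.toNat_of_nonneg (Int.emod_nonneg _ hp0.ne')] at hj
    have h2 : (p : ℤ) ∣ (u - c) - (u - c) % p := Int.dvd_self_sub_emod
    have h3 : A (e.symm j) * u + B (e.symm j) = (A (e.symm j) * ((u - c) % p + c) + B (e.symm j))
      + A (e.symm j) * ((u - c) - (u - c) % p) := by ring
    rw [h3]
    exact dvd_add hj (h2.mul_left _))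
  refine (hinf.image (f := fun m : ℕ => (m : ℤ) + c) (by intro x _ y _; simp)).mono ?_
  rintro _ ⟨m, hm, rfl⟩ i
  have h1 := hm (e i)
  have h2 := key (e i) m
  rw [e.symm_apply_apply] at h2
  rw [isPr_iff_natAbs, ← hsign i, ← h2, Int.natAbs_natCast]
  exact h1

theorem exists_prime_forall_not_dvd {ι : Type*} [Finite ι] (z : ι → ℤ) (hz : ∀ i, z i ≠ 0) :
    ∃ q : ℕ, q.Prime ∧ ∀ i, ¬ (q : ℤ) ∣ z i := by
  have := Fintype.ofFinite ι
  obtain ⟨q, hq, hqp⟩ := Nat.exists_infinite_primes (∑ i, (z i).natAbs + 1)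
  refine ⟨q, hqp, fun i h => ?_⟩
  have h1 := Nat.le_of_dvd (Int.natAbs_pos.mpr (hz i)) (Int.natCast_dvd.mp h)
  have h2 := Finset.single_le_sum (f := fun i => (z i).natAbs) (fun j _ => Nat.zero_le _)
    (Finset.mem_univ i)
  lia

theorem exists_dvd_linear {q : ℕ} (hq : q.Prime) {C : ℤ} (D : ℤ) (hC : ¬ (q : ℤ) ∣ C) :
    ∃ r : ℤ, (q : ℤ) ∣ C * r + D := by
  have hcop : IsCoprime C (q : ℤ) :=
    ((Nat.prime_iff_prime_int.mp hq).coprime_iff_not_dvd.mpr hC).symm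
  obtain ⟨x, y, hxy⟩ := hcop
  refine ⟨-D * x, D * y, ?_⟩
  linear_combination (-D) * hxy

theorem finite_setOf_linear_eq {C : ℤ} (hC : C ≠ 0) (D z : ℤ) : {u : ℤ | C * u + D = z}.Finite := by
  refine Set.Subsingleton.finite fun x hx y hy => mul_left_cancel₀ hC ?_
  have hx : C * x + D = z := hx
  have hy : C * y + D = z := hy
  linarith

/-- Under Dickson's conjecture, a locally admissible family `A i * u + B i` takes prime values (up
to sign) simultaneously at infinitely many points where, moreover, no `C j * u + D j` is prime up to
sign, provided none of the latter forms is `±` one of the former. If `C j * u + D j` is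
proportional to some `A i * u + B i`, it is a proper multiple of it; otherwise it is made divisible
by a suitable auxiliary prime, and it equals `±` that prime at most twice. -/
theorem DicksonConjecture.infinite_isPr_not_isPr (hD : DicksonConjecture) {ι κ : Type*} [Finite ι]
    (A B : ι → ℤ) (hA : ∀ i, A i ≠ 0)
    (hloc : ∀ p : ℕ, p.Prime → ∃ u : ℤ, ∀ i, ¬ (p : ℤ) ∣ A i * u + B i)
    (S : Finset κ) (C D : κ → ℤ) (hC : ∀ j ∈ S, C j ≠ 0)
    (hne : ∀ j ∈ S, ∀ i, ¬ (C j = A i ∧ D j = B i) ∧ ¬ (C j = - A i ∧ D j = - B i)) :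
    {u : ℤ | (∀ i, IsPr (A i * u + B i)) ∧ ∀ j ∈ S, ¬ IsPr (C j * u + D j)}.Infinite := by
  classical
  induction S using Finset.induction_on generalizing A B C D with
  | empty => simpa using hD.infinite_isPr A B hA hloc
  | insert j S hj ih =>
    by_cases hprop : ∃ i, A i * D j = B i * C j
    · obtain ⟨i, hi⟩ := hprop
      have hcop : IsCoprime (A i) (B i) := by
        rw [Int.isCoprime_iff_gcd_eq_one]
        by_contra hg
        obtain ⟨p, hp, hpg⟩ := Nat.exists_prime_and_dvd hg
        obtain ⟨u, hu⟩ := hloc p hp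
        have h := Int.natCast_dvd_natCast.mpr hpg
        exact hu i (dvd_add ((h.trans (Int.gcd_dvd_left ..)).mul_right u)
          (h.trans (Int.gcd_dvd_right ..)))
      obtain ⟨l, hl⟩ : A i ∣ C j := hcop.dvd_of_dvd_mul_left (Dvd.intro _ hi)
      have hl' : D j = l * B i := mul_left_cancel₀ (hA i) (by rw [hi, hl]; ring)
      have hl1 : l.natAbs ≠ 1 := by
        intro h1
        have := hne j (Finset.mem_insert_self ..) i
        rcases Int.natAbs_eq l with h | h <;> rw [h1] at h <;> rw [h] at hl hl' <;>
          simp [hl, hl'] at this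
      refine (ih A B hA hloc C D (fun j' h => hC j' (Finset.mem_insert_of_mem h))
        (fun j' h => hne j' (Finset.mem_insert_of_mem h))).mono ?_
      rintro u ⟨hu1, hu2⟩
      refine ⟨hu1, fun j' hj' => ?_⟩
      rcases Finset.mem_insert.mp hj' with rfl | hj'
      · have h1 := (isPr_iff_natAbs _).mp (hu1 i)
        rw [isPr_iff_natAbs, show C j' * u + D j' = l * (A i * u + B i) by rw [hl, hl']; ring,
          Int.natAbs_mul]
        exact Nat.not_prime_mul hl1 h1.ne_one
      · exact hu2 j' hj'
    · push Not at hprop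
      have hCj := hC j (Finset.mem_insert_self ..)
      obtain ⟨q, hq, hqn⟩ := exists_prime_forall_not_dvd
        (fun o : Option ι => o.elim (C j) (fun i => A i * D j - B i * C j)) (by
          rintro (_ | i)
          · exact hCj
          · exact sub_ne_zero.mpr (hprop i))
      -- As `q` does not divide the resultants `A i * D j - B i * C j`, making `C j * u + D j`
      -- divisible by `q` is compatible with the local condition at `q`.
      have hqC : ¬ (q : ℤ) ∣ C j := hqn none
      obtain ⟨r, hr⟩ := exists_dvd_linear hq (D j) hqC
      have hq0 : (q : ℤ) ≠ 0 := by exact_mod_cast hq.ne_zero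
      have hinf := ih (fun i => A i * q) (fun i => A i * r + B i) (fun i => mul_ne_zero (hA i) hq0)
        (by
          intro p hp
          by_cases hpq : p = q
          · subst hpq
            refine ⟨0, fun i h => hqn (some i) ?_⟩
            have h1 := (hr.mul_left (A i)).sub (h.mul_left (C j))
            have h2 : A i * D j - B i * C j =
                A i * (C j * r + D j) - C j * (A i * p * 0 + (A i * r + B i)) := by ring
            change (p : ℤ) ∣ A i * D j - B i * C j
            rw [h2]
            exact h1
          · have hpq' : ¬ (p : ℤ) ∣ q := by
              rw [Int.natCast_dvd_natCast, Nat.prime_dvd_prime_iff_eq hp hq]; exact hpq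
            obtain ⟨u, hu⟩ := hloc p hp
            obtain ⟨w, hw⟩ := exists_dvd_linear hp (r - u) hpq'
            refine ⟨w, fun i h => hu i ?_⟩
            have h1 := h.sub (hw.mul_left (A i))
            have h2 : A i * u + B i =
                A i * q * w + (A i * r + B i) - A i * (q * w + (r - u)) := by ring
            exact h2 ▸ h1)
        (fun i => C i * q) (fun i => C i * r + D i)
        (fun j' h => mul_ne_zero (hC j' (Finset.mem_insert_of_mem h)) hq0)
        (by
          intro j' hj' i
          have := hne j' (Finset.mem_insert_of_mem hj') i
          refine ⟨fun h => this.1 ?_, fun h => this.2 ?_⟩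
          · have h1 := mul_right_cancel₀ hq0 h.1
            exact ⟨h1, by have := h.2; rw [h1] at this; linarith⟩
          · have h1 : C j' = - A i := mul_right_cancel₀ hq0 (by rw [h.1]; ring)
            exact ⟨h1, by have := h.2; rw [h1] at this; linarith⟩)
      have hCq : C j * q ≠ 0 := mul_ne_zero hCj hq0
      -- `C j * u + D j` is divisible by `q`, hence prime only if it equals `± q`.
      have hinf' := hinf.sdiff ((finite_setOf_linear_eq hCq (C j * r + D j) q).union
        (finite_setOf_linear_eq hCq (C j * r + D j) (-q)))
      refine (hinf'.image (f := fun w : ℤ => q * w + r) (by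
        intro x _ y _ h
        exact mul_left_cancel₀ hq0 (add_right_cancel h))).mono ?_
      rintro _ ⟨w, ⟨⟨hw1, hw2⟩, hw3⟩, rfl⟩
      have hrw : ∀ a b : ℤ, a * (q * w + r) + b = a * q * w + (a * r + b) := fun a b => by ring
      refine ⟨fun i => by rw [hrw]; exact hw1 i, fun j' hj' => ?_⟩
      rcases Finset.mem_insert.mp hj' with rfl | hj'
      · intro hpr
        rw [isPr_iff_natAbs] at hpr
        have h1 : (q : ℤ) ∣ C j' * (q * w + r) + D j' := by
          have : C j' * (q * w + r) + D j' = q * (C j' * w) + (C j' * r + D j') := by ring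
          rw [this]
          exact dvd_add (dvd_mul_right ..) hr
        have h2 := (Nat.prime_dvd_prime_iff_eq hq hpr).mp (Int.natCast_dvd.mp h1)
        apply hw3
        rw [hrw] at h2
        rcases Int.natAbs_eq (C j' * q * w + (C j' * r + D j')) with h | h
        · left
          rw [← h2] at h
          exact h
        · right
          rw [← h2] at h
          exact h
      · rw [hrw]; exact hw2 j' hj'

/-! ### Solvability of a finite system of conditions in one variable -/

/-- The three sorts of atomic conditions on an integer `z`; see `Kind.Holds`. -/
inductive Kind
  | eq
  | dvd
  | pr

/-- The atomic condition of the given kind and modulus `m` on an integer `z`: `z = 0` (with `m`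
playing no role), `m ∣ z`, or `z` is `m` times a prime or the negation of a prime. For `m = 1` the
last two are the trivial condition and the predicate `Pr`. -/
def Kind.Holds : Kind → ℕ → ℤ → Prop
  | .eq, _, z => z = 0
  | .dvd, m, z => (m : ℤ) ∣ z
  | .pr, m, z => ∃ w, z = m * w ∧ IsPr w

/-- For a positive modulus, the condition of kind `pr` is the predicate `Pr_m` as it is interpreted
in `ℤ`. -/
theorem Kind.holds_pr_iff {m : ℕ} (hm : 0 < m) (z : ℤ) :
    Kind.pr.Holds m z ↔ (m : ℤ) ∣ z ∧ IsPr (z / m) := by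
  constructor
  · rintro ⟨w, hw, hwp⟩
    exact ⟨⟨w, hw⟩, by rwa [hw, Int.mul_ediv_cancel_left _ (by exact_mod_cast hm.ne')]⟩
  · rintro ⟨h, hp⟩
    exact ⟨_, (Int.mul_ediv_cancel' h).symm, hp⟩

theorem Kind.holds_mul_iff (k : Kind) (m : ℕ) {n : ℤ} (hn : n ≠ 0) (z : ℤ) :
    k.Holds (n.natAbs * m) (n * z) ↔ k.Holds m z := by
  cases k with
  | eq => simp [Holds, hn]
  | dvd =>
    simp only [Holds]
    push_cast
    rcases abs_choice n with h | h
    · rw [h, mul_dvd_mul_iff_left hn]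
    · rw [h, neg_mul, neg_dvd, mul_dvd_mul_iff_left hn]
  | pr =>
    simp only [Holds]
    rcases abs_choice n with h | h
    · refine exists_congr fun w => and_congr_left fun _ => ?_
      push_cast
      rw [h, mul_assoc, mul_right_inj' hn]
    · refine (Equiv.neg ℤ).exists_congr fun w => ?_
      push_cast
      rw [h, Equiv.neg_apply, isPr_neg, show -n * m * w = n * (m * -w) by ring, mul_right_inj' hn]

theorem exists_forall_not_dvd_linear {ι : Type*} [Fintype ι] {p : ℕ} (hp : p.Prime)
    (hcard : Fintype.card ι < p) (A B : ι → ℤ) (hA : ∀ i, ¬ (p : ℤ) ∣ A i) :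
    ∃ u : ℤ, ∀ i, ¬ (p : ℤ) ∣ A i * u + B i := by
  by_contra! h
  choose f hf using fun u : Fin p => h (u : ℕ)
  obtain ⟨u, v, huv, hfuv⟩ := Fintype.exists_ne_map_eq_of_card_lt f (by simpa using hcard)
  have h1 := (hf u).sub (hfuv ▸ hf v)
  rw [add_sub_add_right_eq_sub, ← mul_sub] at h1
  have h2 := (Int.Prime.dvd_mul' hp h1).resolve_left (hA _)
  have hu := u.2
  have hv := v.2
  have h3 := Int.eq_zero_of_abs_lt_dvd h2 (by rw [abs_lt]; constructor <;> omega)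
  exact huv (Fin.ext (by lia))

/-- The generic solvability criterion for a finite system of conditions, `r` being a candidate for
the residue modulo `N` of a solution. The index `i` stands for the condition of kind `k i` and
modulus `m i` on `a i * x + b i`, which has to hold if and only if `σ i` does. The four clauses:
the conditions determined by the residue of `x` are as prescribed; the forms required to be `m i`
times a prime are divisible by `m i`; at every prime up to `Bd` there is no local obstruction to
the quotients being prime; and no quotient required to be prime is `±` one required not to be.
The criterion consists of finitely many congruences and equations in the constant terms `b i`, so
it is quantifier-free in parameters on which `b` depends affinely. -/
def GenericAt {ι : Type*} (k : ι → Kind) (m : ι → ℕ) (a b : ι → ℤ) (σ : ι → Prop) (N Bd : ℕ)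
    (r : ℤ) : Prop :=
  (∀ i, (k i = .dvd ∨ a i = 0) → ((k i).Holds (m i) (a i * r + b i) ↔ σ i)) ∧
  (∀ i, (k i = .pr ∧ σ i ∧ a i ≠ 0) → (m i : ℤ) ∣ a i * r + b i) ∧
  (∀ p : Fin (Bd + 1), (p : ℕ).Prime → ∃ u : Fin p, ∀ i, (k i = .pr ∧ σ i ∧ a i ≠ 0) →
    ¬ ((p * m i : ℕ) : ℤ) ∣ a i * (r + N * (u : ℕ)) + b i) ∧
  (∀ i j, ((k i = .pr ∧ σ i ∧ a i ≠ 0) ∧ (k j = .pr ∧ ¬ σ j ∧ a j ≠ 0)) →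
    ¬ (m i * a j = m j * a i ∧ m i * b j - m j * b i = 0) ∧
    ¬ (m i * a j = - (m j * a i) ∧ m i * b j + m j * b i = 0))

/-- Sufficiency of the generic criterion. Here `Bd` is so large that primes above it cause no local
obstruction, and no nontrivial equation is required to hold. -/
theorem exists_of_genericAt (hD : DicksonConjecture) {ι : Type*} [Fintype ι] (k : ι → Kind)
    (m : ι → ℕ) (hm : ∀ i, 0 < m i) (a b : ι → ℤ) (σ : ι → Prop)
    (heq : ∀ i, k i = .eq → σ i → a i = 0) {N Bd : ℕ} (hN : 0 < N) (hmN : ∀ i, m i ∣ N)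
    (hBd : ∀ p : ℕ, Bd < p → Fintype.card ι < p ∧ ∀ i, a i ≠ 0 → ¬ (p : ℤ) ∣ a i * N) (r : ℤ)
    (hr : GenericAt k m a b σ N Bd r) :
    ∃ x : ℤ, ∀ i, ((k i).Holds (m i) (a i * x + b i) ↔ σ i) := by
  classical
  obtain ⟨ha, hb, hc, hd⟩ := hr
  have hm0 : ∀ i, (m i : ℤ) ≠ 0 := fun i => by exact_mod_cast (hm i).ne'
  have hN0 : (N : ℤ) ≠ 0 := by exact_mod_cast hN.ne'
  let n : ι → ℤ := fun i => ((N / m i : ℕ) : ℤ)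
  have hn : ∀ i, (m i : ℤ) * n i = N := fun i => by
    rw [← Nat.cast_mul, Nat.mul_div_cancel' (hmN i)]
  have hn0 : ∀ i, n i ≠ 0 := fun i h => hN0 (by rw [← hn i, h, mul_zero])
  let B : ι → ℤ := fun i => (a i * r + b i) / m i
  have hB : ∀ i, (m i : ℤ) ∣ a i * r + b i → (m i : ℤ) * B i = a i * r + b i :=
    fun i h => Int.mul_ediv_cancel' h
  have key : ∀ i, (m i : ℤ) ∣ a i * r + b i → ∀ u,
      a i * (r + N * u) + b i = m i * (a i * n i * u + B i) := fun i h u => by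
    linear_combination (-a i * u) * hn i - hB i h
  let ι' := {i // k i = .pr ∧ σ i ∧ a i ≠ 0}
  let S : Finset ι := {j | (k j = .pr ∧ ¬ σ j ∧ a j ≠ 0) ∧ (m j : ℤ) ∣ a j * r + b j}
  have hS : ∀ j, j ∈ S ↔ (k j = .pr ∧ ¬ σ j ∧ a j ≠ 0) ∧ (m j : ℤ) ∣ a j * r + b j :=
    fun j => by simp [S]
  have hinf := hD.infinite_isPr_not_isPr (fun i : ι' => a i * n i) (fun i => B i)
    (fun i => mul_ne_zero i.2.2.2 (hn0 i)) (by
      intro p hp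
      rcases Nat.lt_or_ge Bd p with h | h
      · refine exists_forall_not_dvd_linear hp
          ((Fintype.card_subtype_le _).trans_lt (hBd p h).1) _ _ fun i hi => ?_
        refine (hBd p h).2 i i.2.2.2 (hi.trans ⟨m i, ?_⟩)
        linear_combination (-a i) * hn i
      · obtain ⟨u, hu⟩ := hc ⟨p, by lia⟩ hp
        refine ⟨(u : ℕ), fun i hi => hu i i.2 ?_⟩
        rw [key i (hb i i.2)]
        push_cast
        rw [mul_comm (p : ℤ)]
        exact mul_dvd_mul_left _ hi)
    S (fun j => a j * n j) B (fun j hj => mul_ne_zero ((hS j).mp hj).1.2.2 (hn0 j)) (by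
      intro j hj i
      rw [hS] at hj
      have h1 := hB i (hb i i.2)
      have h2 := hB j hj.2
      have h3 := hn i
      have h4 := hn j
      have h5 := hd i j ⟨i.2, hj.1⟩
      refine ⟨fun h => h5.1 ?_, fun h => h5.2 ?_⟩
      · have h6 : (m i : ℤ) * a j = m j * a i := by
          refine mul_right_cancel₀ hN0 ?_
          linear_combination (-a j * m i) * h4 + (m i * m j) * h.1 + (m j * a i) * h3
        exact ⟨h6, by
          linear_combination (m i : ℤ) * m j * h.2 + (m j : ℤ) * h1 - (m i : ℤ) * h2 - r * h6⟩
      · have h6 : (m i : ℤ) * a j = -(m j * a i) := by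
          refine mul_right_cancel₀ hN0 ?_
          linear_combination (-a j * m i) * h4 + (m i * m j) * h.1 - (m j * a i) * h3
        exact ⟨h6, by
          linear_combination (m i : ℤ) * m j * h.2 - (m j : ℤ) * h1 - (m i : ℤ) * h2 - r * h6⟩)
  -- Only finitely many points satisfy one of the equations, and all equations are negated here.
  have hfin : (⋃ i : {i // a i ≠ 0}, {u : ℤ | a i * N * u + (a i * r + b i) = 0}).Finite :=
    Set.finite_iUnion fun i => finite_setOf_linear_eq (mul_ne_zero i.2 hN0) _ _
  obtain ⟨u, ⟨hu1, hu2⟩, hu3⟩ := (hinf.sdiff hfin).nonempty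
  have hmod : ∀ i, (m i : ℤ) ∣ a i * (r + N * u) + b i ↔ (m i : ℤ) ∣ a i * r + b i := fun i => by
    have h1 : (m i : ℤ) ∣ a i * N * u := by rw [← hn i]; exact ⟨a i * n i * u, by ring⟩
    rw [show a i * (r + N * u) + b i = a i * N * u + (a i * r + b i) by ring, dvd_add_right h1]
  refine ⟨r + N * u, fun i => ?_⟩
  by_cases hai : a i = 0
  · have := ha i (.inr hai)
    simpa [hai] using this
  cases hk : k i with
  | dvd =>
    rw [← ha i (.inl hk), hk]
    exact hmod i
  | eq =>
    have h1 : ¬ σ i := fun h => hai (heq i hk h)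
    refine iff_of_false (fun h => hu3 (Set.mem_iUnion.mpr ⟨⟨i, hai⟩, ?_⟩)) h1
    have h : a i * (r + N * u) + b i = 0 := h
    rw [Set.mem_ofPred_eq]
    linear_combination h
  | pr =>
    by_cases hσ : σ i
    · exact iff_of_true ⟨_, key i (hb i ⟨hk, hσ, hai⟩) u, hu1 ⟨i, hk, hσ, hai⟩⟩ hσ
    · refine iff_of_false ?_ hσ
      rintro ⟨w, hw, hwp⟩
      have hdvd := (hmod i).mp ⟨w, hw⟩
      rw [key i hdvd, mul_right_inj' (hm0 i)] at hw
      exact hu2 i ((hS i).mpr ⟨⟨hk, hσ, hai⟩, hdvd⟩) (hw ▸ hwp)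

/-- A solution of a finite system of conditions either makes the quotient of one of the required
prime conditions equal to a bounded number, or satisfies the generic criterion. -/
theorem genericAt_of_forall {ι : Type*} (k : ι → Kind) (m : ι → ℕ) (hm : ∀ i, 0 < m i)
    (a b : ι → ℤ) (σ : ι → Prop) {N Bd : ℕ} (hmN : ∀ i, m i ∣ N) (x : ℤ)
    (hx : ∀ i, ((k i).Holds (m i) (a i * x + b i) ↔ σ i))
    (hspec : ∀ i, (k i = .pr ∧ σ i ∧ a i ≠ 0) → ∀ z ∈ Finset.Icc (-Bd : ℤ) Bd,
      a i * x + b i ≠ z * m i) :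
    GenericAt k m a b σ N Bd (x % N) := by
  have hm0 : ∀ i, (m i : ℤ) ≠ 0 := fun i => by exact_mod_cast (hm i).ne'
  have hmN' : ∀ i, (m i : ℤ) ∣ N := fun i => Int.natCast_dvd_natCast.mpr (hmN i)
  have hxN := Int.emod_add_mul_ediv x N
  have hmod : ∀ i, (m i : ℤ) ∣ a i * (x % N) + b i ↔ (m i : ℤ) ∣ a i * x + b i := fun i => by
    have h1 : a i * x + b i = N * (a i * (x / N)) + (a i * (x % N) + b i) := by
      linear_combination (-a i) * hxN
    rw [h1, dvd_add_right ((hmN' i).mul_right _)]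
  have hpr : ∀ i, (k i = .pr ∧ σ i ∧ a i ≠ 0) → ∃ w, a i * x + b i = m i * w ∧ IsPr w := by
    rintro i ⟨hk, hσ, -⟩
    have := (hx i).mpr hσ
    rwa [hk] at this
  refine ⟨fun i hi => ?_, fun i hi => ?_, fun p hp => ?_, fun i j hij => ?_⟩
  · rw [← hx i]
    by_cases hai : a i = 0
    · simp [hai]
    · rw [hi.resolve_right hai]
      exact hmod i
  · obtain ⟨w, hw, -⟩ := hpr i hi
    exact (hmod i).mpr ⟨w, hw⟩
  · have hp0 : (0 : ℤ) < (p : ℕ) := by exact_mod_cast hp.pos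
    have hu0 := Int.emod_nonneg (x / N) hp0.ne'
    have hu1 := Int.emod_lt_of_pos (x / N) hp0
    refine ⟨⟨((x / N) % (p : ℕ)).toNat, by lia⟩, fun i hi hdvd => ?_⟩
    rw [Int.toNat_of_nonneg hu0] at hdvd
    obtain ⟨w, hw, hwp⟩ := hpr i hi
    have h1 := Int.emod_add_mul_ediv (x / N) (p : ℕ)
    have h2 : ((p * m i : ℕ) : ℤ) ∣ a i * x + b i := by
      have h3 : a i * x + b i = (a i * (x % N + N * ((x / N) % (p : ℕ))) + b i)
          + ((p : ℕ) * N) * (a i * (x / N / (p : ℕ))) := by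
        linear_combination (-a i) * hxN - a i * N * h1
      rw [h3]
      push_cast at hdvd ⊢
      exact dvd_add hdvd ((mul_dvd_mul_left _ (hmN' i)).mul_right _)
    rw [hw, Nat.cast_mul, mul_comm (m i : ℤ), mul_dvd_mul_iff_right (hm0 i)] at h2
    rw [isPr_iff_natAbs] at hwp
    have h3 := (Nat.prime_dvd_prime_iff_eq hp hwp).mp (Int.natCast_dvd.mp h2)
    have h4 := p.2
    refine hspec i hi w (Finset.mem_Icc.mpr (by lia)) (by rw [hw, mul_comm])
  · obtain ⟨hi, hkj, hσj, -⟩ := hij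
    obtain ⟨w, hw, hwp⟩ := hpr i hi
    rw [← hx j, hkj] at hσj
    refine ⟨fun h => hσj ⟨w, ?_, hwp⟩, fun h => hσj ⟨-w, ?_, (isPr_neg w).mpr hwp⟩⟩
    · refine mul_left_cancel₀ (hm0 i) ?_
      linear_combination x * h.1 + h.2 + m j * hw
    · refine mul_left_cancel₀ (hm0 i) ?_
      linear_combination x * h.1 + h.2 - m j * hw

/-! ### Quantifier-free definable predicates -/

open Language

section Definability

variable {β : Type}

/-- A function of integer parameters is a term function if it is the interpretation in `ℤ` of a term
of `L*`, that is, an affine function with integer coefficients. -/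
def IsTermFun (t : (β → ℤ) → ℤ) : Prop :=
  ∃ τ : Lstar.Term β, ∀ y, τ.realize y = t y

theorem isTermFun_var (i : β) : IsTermFun fun y => y i :=
  ⟨Term.var i, fun _ => rfl⟩

theorem IsTermFun.neg {t : (β → ℤ) → ℤ} (ht : IsTermFun t) : IsTermFun fun y => - t y := by
  obtain ⟨τ, hτ⟩ := ht
  exact ⟨Term.func (L := Lstar) Func.neg fun _ => τ, fun y => congrArg (- ·) (hτ y)⟩

theorem IsTermFun.add {s t : (β → ℤ) → ℤ} (hs : IsTermFun s) (ht : IsTermFun t) :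
    IsTermFun fun y => s y + t y := by
  obtain ⟨σ, hσ⟩ := hs
  obtain ⟨τ, hτ⟩ := ht
  exact ⟨Term.func (L := Lstar) Func.add ![σ, τ], fun y => congrArg₂ (· + ·) (hσ y) (hτ y)⟩

theorem IsTermFun.sub {s t : (β → ℤ) → ℤ} (hs : IsTermFun s) (ht : IsTermFun t) :
    IsTermFun fun y => s y - t y := by
  simpa only [sub_eq_add_neg] using hs.add ht.neg

theorem isTermFun_zero : IsTermFun fun _ : β → ℤ => 0 :=
  ⟨Term.func (L := Lstar) Func.zero Fin.elim0, fun _ => rfl⟩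

theorem isTermFun_one : IsTermFun fun _ : β → ℤ => 1 :=
  ⟨Term.func (L := Lstar) Func.one Fin.elim0, fun _ => rfl⟩

theorem IsTermFun.const_mul {t : (β → ℤ) → ℤ} (ht : IsTermFun t) (n : ℤ) :
    IsTermFun fun y => n * t y := by
  induction n with
  | zero => simpa using isTermFun_zero
  | succ n ih => simpa only [add_mul, one_mul] using ih.add ht
  | pred n ih => simpa only [sub_mul, one_mul] using ih.sub ht

theorem isTermFun_const (n : ℤ) : IsTermFun fun _ : β → ℤ => n := by
  simpa using (isTermFun_one (β := β)).const_mul n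

/-- A predicate of integer parameters is `QFDef` if it is defined in `ℤ` by a quantifier-free
formula of `L*`. -/
def QFDef (P : (β → ℤ) → Prop) : Prop :=
  ∃ ψ : Lstar.Formula β, ψ.IsQF ∧ ∀ y, ψ.Realize y ↔ P y

theorem QFDef.congr {P Q : (β → ℤ) → Prop} (hP : QFDef P) (h : ∀ y, Q y ↔ P y) : QFDef Q := by
  rwa [show Q = P from funext fun y => propext (h y)]

theorem qfDef_const (p : Prop) : QFDef fun _ : β → ℤ => p := by
  by_cases hp : p
  · exact ⟨⊤, .top, fun y => by simp [hp]⟩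
  · exact ⟨⊥, .falsum, fun y => by simp [hp]⟩

theorem QFDef.imp {P Q : (β → ℤ) → Prop} (hP : QFDef P) (hQ : QFDef Q) :
    QFDef fun y => P y → Q y := by
  obtain ⟨φ, hφ, hφ'⟩ := hP
  obtain ⟨ψ, hψ, hψ'⟩ := hQ
  exact ⟨φ.imp ψ, hφ.imp hψ, fun y => by rw [Formula.realize_imp, hφ', hψ']⟩

theorem QFDef.not {P : (β → ℤ) → Prop} (hP : QFDef P) : QFDef fun y => ¬ P y :=
  hP.imp (qfDef_const False)

theorem QFDef.or {P Q : (β → ℤ) → Prop} (hP : QFDef P) (hQ : QFDef Q) :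
    QFDef fun y => P y ∨ Q y :=
  (hP.not.imp hQ).congr fun _ => or_iff_not_imp_left

theorem QFDef.and {P Q : (β → ℤ) → Prop} (hP : QFDef P) (hQ : QFDef Q) :
    QFDef fun y => P y ∧ Q y :=
  (hP.imp hQ.not).not.congr fun _ => by tauto

theorem QFDef.iff {P Q : (β → ℤ) → Prop} (hP : QFDef P) (hQ : QFDef Q) :
    QFDef fun y => (P y ↔ Q y) :=
  ((hP.imp hQ).and (hQ.imp hP)).congr fun _ => iff_iff_implies_and_implies

theorem QFDef.exists {ι : Type*} [Finite ι] {P : ι → (β → ℤ) → Prop} (hP : ∀ i, QFDef (P i)) :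
    QFDef fun y => ∃ i, P i y := by
  classical
  have := Fintype.ofFinite ι
  have h : ∀ s : Finset ι, QFDef fun y => ∃ i ∈ s, P i y := fun s => by
    induction s using Finset.induction_on with
    | empty => simpa using qfDef_const False
    | insert i s _ ih => simpa using (hP i).or ih
  simpa using h Finset.univ

theorem QFDef.forall {ι : Type*} [Finite ι] {P : ι → (β → ℤ) → Prop} (hP : ∀ i, QFDef (P i)) :
    QFDef fun y => ∀ i, P i y :=
  (QFDef.exists fun i => (hP i).not).not.congr fun _ => by simp

theorem QFDef.imp_left {P : (β → ℤ) → Prop} (p : Prop) (hP : p → QFDef P) :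
    QFDef fun y => p → P y := by
  by_cases hp : p
  · simpa [hp] using hP hp
  · simpa [hp] using qfDef_const True

theorem qfDef_rel (R : Lstar.Relations 1) {t : (β → ℤ) → ℤ} (ht : IsTermFun t) :
    QFDef fun y => relInterp R fun _ => t y := by
  obtain ⟨τ, hτ⟩ := ht
  refine ⟨R.formula₁ τ, .of_isAtomic (.rel _ _), fun y => ?_⟩
  rw [Formula.realize_rel₁, hτ, show ![t y] = fun _ => t y from funext fun i => by simp]
  rfl

theorem QFDef.eq_zero {t : (β → ℤ) → ℤ} (ht : IsTermFun t) : QFDef fun y => t y = 0 := by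
  obtain ⟨τ, hτ⟩ := ht
  obtain ⟨ζ, hζ⟩ := isTermFun_zero (β := β)
  exact ⟨τ.equal ζ, .of_isAtomic (.equal _ _), fun y => by rw [Formula.realize_equal, hτ, hζ]⟩

theorem qfDef_holds (k : Kind) {m : ℕ} (hm : 0 < m) {t : (β → ℤ) → ℤ} (ht : IsTermFun t) :
    QFDef fun y => k.Holds m (t y) := by
  rcases (show m = 1 ∨ 2 ≤ m by lia) with rfl | hm2
  · cases k with
    | eq => exact .eq_zero ht
    | dvd => exact (qfDef_const True).congr fun y => by simp [Kind.Holds]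
    | pr => exact (qfDef_rel .pr ht).congr fun y => by simp [Kind.Holds, relInterp]
  · cases k with
    | eq => exact .eq_zero ht
    | dvd => exact qfDef_rel (.dvd m hm2) ht
    | pr =>
      exact (qfDef_rel (.prN m hm2) ht).congr fun y => Kind.holds_pr_iff hm _

theorem QFDef.dvd {m : ℕ} (hm : 0 < m) {t : (β → ℤ) → ℤ} (ht : IsTermFun t) :
    QFDef fun y => (m : ℤ) ∣ t y :=
  qfDef_holds .dvd hm ht

end Definability

/-! ### Projections of quantifier-free definable sets -/

section Projection

variable {β : Type}

/-- An atomic condition, of the given kind and modulus, on `a * x + t y`, where `x` is a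
distinguished variable and `y` a tuple of parameters. -/
structure Atom (β : Type) where
  kind : Kind
  m : ℕ
  m_pos : 0 < m
  a : ℤ
  t : (β → ℤ) → ℤ
  isTermFun : IsTermFun t

/-- The truth of an atomic condition at `x` and `y`. -/
def Atom.Holds (A : Atom β) (x : ℤ) (y : β → ℤ) : Prop :=
  A.kind.Holds A.m (A.a * x + A.t y)

/-- A variable determined by a linear equation `n * x = s y` can be eliminated: multiply each
condition by `n` and substitute. This is where the predicates `Pr_n` are needed. -/
theorem QFDef.exists_mul_eq {ι : Type*} [Finite ι] (A : ι → Atom β) (σ : ι → Prop) {n : ℤ}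
    (hn : n ≠ 0) {s : (β → ℤ) → ℤ} (hs : IsTermFun s) :
    QFDef fun y => ∃ x, n * x = s y ∧ ∀ i, ((A i).Holds x y ↔ σ i) := by
  have hn' := Int.natAbs_pos.mpr hn
  refine ((QFDef.dvd hn' hs).and (QFDef.forall fun i =>
    (qfDef_holds (A i).kind (Nat.mul_pos hn' (A i).m_pos)
      ((hs.const_mul (A i).a).add ((A i).isTermFun.const_mul n))).iff
        (qfDef_const (σ i)))).congr fun y => ?_
  have key : ∀ x, n * x = s y → ∀ i, ((A i).Holds x y ↔
      (A i).kind.Holds (n.natAbs * (A i).m) ((A i).a * s y + n * (A i).t y)) := fun x hx i => by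
    rw [← hx, show (A i).a * (n * x) + n * (A i).t y = n * ((A i).a * x + (A i).t y) by ring,
      Kind.holds_mul_iff _ _ hn]
    rfl
  rw [Int.natAbs_dvd]
  constructor
  · rintro ⟨x, hx, h⟩
    exact ⟨⟨x, hx.symm⟩, fun i => (key x hx i).symm.trans (h i)⟩
  · rintro ⟨⟨x, hx⟩, h⟩
    exact ⟨x, hx.symm, fun i => (key x hx.symm i).trans (h i)⟩

theorem qfDef_genericAt {ι : Type*} [Finite ι] (A : ι → Atom β) (σ : ι → Prop) (N Bd : ℕ) (r : ℤ) :
    QFDef fun y => GenericAt (fun i => (A i).kind) (fun i => (A i).m) (fun i => (A i).a)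
      (fun i => (A i).t y) σ N Bd r := by
  have hlin : ∀ i x, IsTermFun fun y => (A i).a * x + (A i).t y := fun i x =>
    (isTermFun_const _).add (A i).isTermFun
  refine .and ?_ (.and ?_ (.and ?_ ?_))
  · exact .forall fun i => .imp_left _ fun _ =>
      (qfDef_holds _ (A i).m_pos (hlin i r)).iff (qfDef_const _)
  · exact .forall fun i => .imp_left _ fun _ => .dvd (A i).m_pos (hlin i r)
  · exact .forall fun p => .imp_left _ fun hp => .exists fun u => .forall fun i =>
      .imp_left _ fun _ => .not (.dvd (Nat.mul_pos hp.pos (A i).m_pos) (hlin i _))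
  · exact .forall fun i => .forall fun j => .imp_left _ fun _ =>
      .and (.not (.and (qfDef_const _) (.eq_zero
        (((A j).isTermFun.const_mul _).sub ((A i).isTermFun.const_mul _)))))
      (.not (.and (qfDef_const _) (.eq_zero
        (((A j).isTermFun.const_mul _).add ((A i).isTermFun.const_mul _)))))

/-- Elimination of one variable from a system of atomic conditions and negations of such. If a
nontrivial equation is required, solve it. Otherwise, either a required prime condition holds with
one of finitely many small primes, which again amounts to an equation for `x`, or the generic
criterion decides solvability. -/
theorem QFDef.exists_forall_iff (hD : DicksonConjecture) {ι : Type*} [Finite ι] (A : ι → Atom β)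
    (σ : ι → Prop) : QFDef fun y => ∃ x, ∀ i, ((A i).Holds x y ↔ σ i) := by
  have := Fintype.ofFinite ι
  by_cases heq : ∃ i, (A i).kind = .eq ∧ σ i ∧ (A i).a ≠ 0
  · obtain ⟨i, hk, hσ, ha⟩ := heq
    refine (QFDef.exists_mul_eq A σ ha (A i).isTermFun.neg).congr fun y => exists_congr fun x => ?_
    refine ⟨fun h => ⟨?_, h⟩, And.right⟩
    have h1 := (h i).mpr hσ
    rw [Atom.Holds, hk] at h1
    exact eq_neg_of_add_eq_zero_left h1
  push Not at heq
  let N := ∏ i, (A i).m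
  have hN : 0 < N := Finset.prod_pos fun i _ => (A i).m_pos
  have hmN : ∀ i, (A i).m ∣ N := fun i => Finset.dvd_prod_of_mem _ (Finset.mem_univ i)
  -- A prime above `Bd` exceeds the number of forms and divides no leading coefficient, so it is no
  -- local obstruction.
  let Bd := Fintype.card ι + ∑ i, ((A i).a * N).natAbs
  have hBd : ∀ p : ℕ, Bd < p → Fintype.card ι < p ∧
      ∀ i, (A i).a ≠ 0 → ¬ (p : ℤ) ∣ (A i).a * N := fun p hp => by
    refine ⟨by lia, fun i hi hdvd => ?_⟩
    have h1 := Nat.le_of_dvd (Int.natAbs_pos.mpr (mul_ne_zero hi (by exact_mod_cast hN.ne')))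
      (Int.natCast_dvd.mp hdvd)
    have h2 := Finset.single_le_sum (f := fun i => ((A i).a * N).natAbs)
      (fun j _ => Nat.zero_le _) (Finset.mem_univ i)
    lia
  refine ((QFDef.exists fun i : {i // (A i).kind = .pr ∧ σ i ∧ (A i).a ≠ 0} =>
    QFDef.exists fun z : Finset.Icc (-Bd : ℤ) Bd =>
      QFDef.exists_mul_eq A σ i.2.2.2
        ((isTermFun_const (z * (A i).m)).sub (A i).isTermFun)).or
    (QFDef.exists fun r : Fin N => qfDef_genericAt A σ N Bd (r : ℕ))).congr fun y => ?_
  constructor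
  · rintro ⟨x, hx⟩
    rw [or_iff_not_imp_left]
    intro hspec
    have hN0 : (N : ℤ) ≠ 0 := by exact_mod_cast hN.ne'
    have h1 := Int.emod_nonneg x hN0
    have h2 := Int.emod_lt_of_pos x (Int.natCast_pos.mpr hN)
    refine ⟨⟨(x % N).toNat, by lia⟩, ?_⟩
    rw [Int.toNat_of_nonneg h1]
    exact genericAt_of_forall _ _ (fun i => (A i).m_pos) _ _ σ hmN x hx fun i hi z hz h =>
      hspec ⟨⟨i, hi⟩, ⟨z, hz⟩, x, eq_sub_of_add_eq h, hx⟩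
  · rintro (⟨i, z, x, -, hx⟩ | ⟨r, hr⟩)
    · exact ⟨x, hx⟩
    · exact exists_of_genericAt hD _ _ (fun i => (A i).m_pos) _ _ σ heq hN hmN hBd _ hr

variable {γ : Type}

/-- A term in variables, each of which is sent to the distinguished variable (`none`) or to a
parameter, is linear in the distinguished variable. -/
theorem exists_realize_term_eq (e : γ → Option β) (τ : Lstar.Term γ) :
    ∃ (a : ℤ) (t : (β → ℤ) → ℤ), IsTermFun t ∧
      ∀ x y, τ.realize (fun g => (e g).elim x y) = a * x + t y := by
  induction τ with
  | var g =>
    cases h : e g with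
    | none => exact ⟨1, _, isTermFun_zero, fun x y => by simp [h]⟩
    | some i => exact ⟨0, _, isTermFun_var i, fun x y => by simp [h]⟩
  | func f ts ih =>
    choose a t ht h using ih
    rcases f with _ | _ | _ | _
    · exact ⟨0, _, isTermFun_zero, fun x y => by simp; rfl⟩
    · exact ⟨0, _, isTermFun_one, fun x y => by simp; rfl⟩
    · refine ⟨-a 0, _, (ht 0).neg, fun x y => (congrArg (- ·) (h 0 x y)).trans ?_⟩
      ring
    · refine ⟨a 0 + a 1, _, (ht 0).add (ht 1), fun x y =>
        (congrArg₂ (· + ·) (h 0 x y) (h 1 x y)).trans ?_⟩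
      ring

/-- The truth value of a quantifier-free formula is a function of the truth values of finitely many
atomic conditions. -/
theorem exists_atoms_of_isQF (e : γ → Option β) {ψ : Lstar.Formula γ} (hψ : ψ.IsQF) :
    ∃ (ι : Type) (_ : Finite ι) (A : ι → Atom β) (S : Set (ι → Prop)), ∀ x y,
      ψ.Realize (fun g => (e g).elim x y) ↔ (fun i => (A i).Holds x y) ∈ S := by
  have single : ∀ {P : ℤ → (β → ℤ) → Prop} (A : Atom β), (∀ x y, P x y ↔ A.Holds x y) →
      ∃ (ι : Type) (_ : Finite ι) (A : ι → Atom β) (S : Set (ι → Prop)), ∀ x y,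
        P x y ↔ (fun i => (A i).Holds x y) ∈ S := fun A hA =>
    ⟨Unit, inferInstance, fun _ => A, {τ | τ ()}, hA⟩
  have hval : ∀ x (y : β → ℤ) (z : Fin 0 → ℤ), Sum.elim (fun g => (e g).elim x y) z =
      fun g => (Sum.elim e Fin.elim0 g).elim x y := fun x y z => by
    funext g
    rcases g with g | i
    · rfl
    · exact i.elim0
  have hterm := exists_realize_term_eq (Sum.elim e Fin.elim0 : γ ⊕ Fin 0 → Option β)
  induction hψ with
  | falsum => exact ⟨Empty, inferInstance, Empty.elim, ∅, fun x y => Iff.rfl⟩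
  | of_isAtomic h =>
    cases h with
    | equal t₁ t₂ =>
      obtain ⟨a, s, hs, h₁⟩ := hterm t₁
      obtain ⟨b, t, ht, h₂⟩ := hterm t₂
      refine single ⟨.eq, 1, one_pos, a - b, _, hs.sub ht⟩ fun x y => ?_
      rw [Formula.Realize, BoundedFormula.realize_bdEqual, hval, h₁, h₂, ← sub_eq_zero, Atom.Holds,
        show a * x + s y - (b * x + t y) = (a - b) * x + (s y - t y) by ring]
      rfl
    | @rel l R ts =>
      have hrel : ∀ x y, Formula.Realize (R.boundedFormula ts) (fun g => (e g).elim x y) ↔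
          relInterp R fun i => (ts i).realize
            fun g => (Sum.elim e Fin.elim0 g : Option β).elim x y := fun x y => by
        rw [Formula.Realize, BoundedFormula.realize_rel, hval]
        rfl
      rcases R with _ | ⟨n, hn⟩ | ⟨n, hn⟩ <;> obtain ⟨a, t, ht, h⟩ := hterm (ts 0)
      · refine single ⟨.pr, 1, one_pos, a, t, ht⟩ fun x y => (hrel x y).trans ?_
        simp [relInterp, h, Atom.Holds, Kind.Holds]
      · have hn0 : 0 < n := by lia
        refine single ⟨.pr, n, hn0, a, t, ht⟩ fun x y => (hrel x y).trans ?_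
        simp only [relInterp, h, Atom.Holds, Kind.holds_pr_iff hn0]
      · refine single ⟨.dvd, n, by lia, a, t, ht⟩ fun x y => (hrel x y).trans ?_
        simp only [relInterp, h, Atom.Holds, Kind.Holds]
  | imp _ _ ih₁ ih₂ =>
    obtain ⟨ι₁, _, A₁, S₁, h₁⟩ := ih₁
    obtain ⟨ι₂, _, A₂, S₂, h₂⟩ := ih₂
    exact ⟨ι₁ ⊕ ι₂, inferInstance, Sum.elim A₁ A₂, {τ | τ ∘ Sum.inl ∈ S₁ → τ ∘ Sum.inr ∈ S₂},
      fun x y => imp_congr (h₁ x y) (h₂ x y)⟩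

theorem QFDef.exists_of_isQF (hD : DicksonConjecture) (e : γ → Option β) {ψ : Lstar.Formula γ}
    (hψ : ψ.IsQF) : QFDef fun y : β → ℤ => ∃ x : ℤ, ψ.Realize fun g => (e g).elim x y := by
  obtain ⟨ι, _, A, S, h⟩ := exists_atoms_of_isQF e hψ
  refine (QFDef.exists fun σ : S => QFDef.exists_forall_iff hD A σ).congr fun y => ?_
  simp only [h]
  constructor
  · rintro ⟨x, hx⟩
    exact ⟨⟨_, hx⟩, x, fun i => Iff.rfl⟩
  · rintro ⟨⟨σ, hσ⟩, x, hx⟩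
    exact ⟨x, by rwa [show (fun i => (A i).Holds x y) = σ from funext fun i => propext (hx i)]⟩

end Projection

/-- Under Dickson's conjecture every formula, with any number of bound variables in scope, defines a
quantifier-free definable predicate; the bound variables become parameters. -/
theorem qfDef_boundedFormula (hD : DicksonConjecture) {α : Type} {n : ℕ}
    (φ : Lstar.BoundedFormula α n) :
    QFDef fun w : α ⊕ Fin n → ℤ => φ.Realize (w ∘ Sum.inl) (w ∘ Sum.inr) := by
  have hterm : ∀ {n : ℕ} (τ : Lstar.Term (α ⊕ Fin n)), IsTermFun fun w =>
      τ.realize (Sum.elim (w ∘ Sum.inl) (w ∘ Sum.inr)) := fun τ =>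
    ⟨τ, fun w => congrArg (τ.realize ·) (Sum.elim_comp_inl_inr w).symm⟩
  induction φ with
  | falsum => exact qfDef_const False
  | equal t₁ t₂ =>
    exact (QFDef.eq_zero ((hterm t₁).sub (hterm t₂))).congr fun w => sub_eq_zero.symm
  | rel R ts =>
    rcases R with _ | ⟨n, hn⟩ | ⟨n, hn⟩
    · exact qfDef_rel .pr (hterm (ts 0))
    · exact qfDef_rel (.prN n hn) (hterm (ts 0))
    · exact qfDef_rel (.dvd n hn) (hterm (ts 0))
  | imp _ _ ih₁ ih₂ => exact ih₁.imp ih₂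
  | @all n φ ih =>
    obtain ⟨ψ, hψ, h⟩ := ih
    refine (QFDef.exists_of_isQF hD (Sum.elim (fun i => some (Sum.inl i))
      (Fin.lastCases none fun j => some (Sum.inr j)) : α ⊕ Fin (n + 1) → Option (α ⊕ Fin n))
      hψ.not).not.congr fun w => ?_
    simp only [Formula.realize_not, not_exists, not_not, h]
    refine forall_congr' fun x => ?_
    rw [show ∀ f : α ⊕ Fin (n + 1) → Option (α ⊕ Fin n), ((fun g => (f g).elim x w) ∘ Sum.inr) =
      fun j => (f (Sum.inr j)).elim x w from fun f => rfl]
    have : Fin.snoc (w ∘ Sum.inr) x = fun j : Fin (n + 1) =>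
        (Fin.lastCases none (fun j => some (Sum.inr j)) j : Option (α ⊕ Fin n)).elim x w := by
      funext j
      refine Fin.lastCases ?_ (fun j => ?_) j <;> simp
    exact iff_of_eq (congrArg (φ.Realize (w ∘ Sum.inl)) this)

theorem qfDef_formula (hD : DicksonConjecture) {α : Type} (φ : Lstar.Formula α) :
    QFDef fun y : α → ℤ => φ.Realize y := by
  obtain ⟨ψ, hψ, h⟩ := qfDef_boundedFormula hD φ
  refine ⟨Formula.relabel (Sum.elim id Fin.elim0) ψ, hψ.relabel _, fun y => ?_⟩
  rw [Formula.realize_relabel, h]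
  exact iff_of_eq (congrArg (BoundedFormula.Realize φ y) (Subsingleton.elim _ _))

/-- Formulas that are equivalent in `ℤ` are equivalent modulo the complete theory of `ℤ`. -/
theorem iff_completeTheory_of_forall {n : ℕ} {φ ψ : Lstar.Formula (Fin n)}
    (h : ∀ y : Fin n → ℤ, φ.Realize y ↔ ψ.Realize y) : φ ⇔[Lstar.completeTheory ℤ] ψ := by
  refine Theory.models_formula_iff.mpr fun M v => ?_
  let χ : Lstar.Sentence :=
    Formula.iAlls (Fin n) (Formula.relabel Sum.inr (φ.iff ψ) : Lstar.Formula (Empty ⊕ Fin n))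
  have hχ : ∀ (K : Type) [Lstar.Structure K], K ⊨ χ ↔
      ∀ v : Fin n → K, Formula.Realize (φ.iff ψ) v :=
    fun K _ => by
      rw [Sentence.Realize, Formula.realize_iAlls]
      exact forall_congr' fun v => Formula.realize_relabel
  refine (hχ M).mp ((realize_iff_of_model_completeTheory ℤ M χ).mpr ((hχ ℤ).mpr fun y => ?_)) v
  exact Formula.realize_iff.mpr (h y)

end PrimesInt

theorem lemma2p7 (hD : PrimesInt.DicksonConjecture) :
    PrimesInt.EliminatesQuantifiers (PrimesInt.Lstar.completeTheory ℤ) := by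
  intro n φ
  obtain ⟨ψ, hψ, h⟩ := PrimesInt.qfDef_formula hD φ
  exact ⟨ψ, hψ, PrimesInt.iff_completeTheory_of_forall fun y => (h y).symm⟩
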